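/- Let $n,l\ge 0$ and $N\ge 1$ be integers, and for $j=1,\dots,N$ let $a_j:\mathbb R^n\to\mathbb R^l$ and $b_j:\mathbb R^n\to\mathbb R$ be continuously differentiable with $a_j(x)\neq 0$ for all $x\in\mathbb{R}^n$. Put $\Phi(x)=\{c\in\mathbb R^l : a_j(x)^\top c\le b_j(x),\ j=1,\dots,N\}$, and assume that there is a compact set $\mathcal D_y\subset\mathbb R^l$ with $\Phi(x)\subseteq\mathcal D_y$ for all $x\in\mathbb R^n$. Let $\mathcal A=\{x\in\mathbb{R}^n : \operatorname{Int}\Phi(x)\neq\emptyset\}$ and $\epsilon_0>0$. Let $q=(0,\dots,0,-1)^\top\in\mathbb R^{l+1}$. Let $\tilde A(x)\in\mathbb R^{(N+1)\times(l+1)}$ be the matrix with rows $\tilde a_1(x)^\top=(0,\dots,0,-1)$ and $\tilde a_{j+1}(x)^\top=(a_j(x)^\top,\|a_j(x)\|)$ for $j=1,\dots,N$ (Euclidean norm), and let $\tilde b(x)=(0,b_1(x),\dots,b_N(x))^\top$. Put $$F_P(x)=\{z\in\mathbb R^{l+1} : \tilde A(x)z\le\tilde b(x)\},\qquad S(x)=\operatorname*{argmin}_{z\in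 F_P(x)}q^\top z,\qquad h_r(x)=-\epsilon_0-\min_{z\in F_P(x)}q^\top z\quad(x\in\mathcal A).$$ For $z\in F_P(x)$ let $\mathcal J_0(z,x)=\{j : \tilde a_j(x)^\top z=\tilde b_j(x)\}$ be the active index set, let $\tilde A_{\mathcal J_0(z,x)}(x)$ be the submatrix of $\tilde A(x)$ formed by the active rows, and for $\mu\in\mathbb R^{\mathcal J_0(z,x)}$ put $$\partial_xL(\mu,z,x)=\sum_{j\in\mathcal J_0(z,x)}\mu_j\Big(z^\top\frac{\partial\tilde a_j}{\partial x}(x)-\frac{\partial\tilde b_j}{\partial x}(x)\Big),\qquad M(z,x)=\{\mu : \tilde A_{\mathcal J_0(z,x)}(x)^\top\mu=-q,\ \mu\ge 0\}.$$ Then the minimum that defines $h_r$ is attained at every point of $\mathcal A$. For every $x\in\mathcal A$ and every $z\in F_P(x)$, the set $M(z,x)$ is compact; moreover, with the local Lagrangian $L(\mu,w,y)=q^\top w+\sum_{j\in\mathcal J_0(z,x)}\mu_j(\tilde a_j(y)^\top w-\tilde b_j(y))$, in which the index set is kept fixed, the vector $\partial_xL(\mu,z,x)$ is the derivative of $y\mapsto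 L(\mu,z,y)$ at $y=x$, and $M(z,x)$ is the set of all $\mu\ge0$ for which the derivative of $w\mapsto L(\mu,w,x)$ at $w=z$ is $0$. Finally, for every $x\in\mathcal A$ and every direction $\dot x\in\mathbb R^n$, the points $x+\sigma\dot x$ lie in $\mathcal A$ for all sufficiently small $\sigma>0$, the one-sided directional derivative $h_r'(x;\dot x)=\lim_{\sigma\to0^+}\big(h_r(x+\sigma\dot x)-h_r(x)\big)/\sigma$ exists, and $$h_r'(x;\dot x)=\max_{z\in S(x)}\ \min_{\mu\in M(z,x)}\ -\partial_xL(\mu,z,x)\,\dot x,$$ where the minima and the maximum are attained. -/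

import Mathlib

open scoped Topology

noncomputable section

/-- The data of a state-dependent polytope
`Φ(x) = {c ∈ ℝ^l | a_j(x)ᵀ c ≤ b_j(x), j = 1, …, N}`, with state `x ∈ ℝ^n`. -/
structure ParamPolytope (n l N : ℕ) where
  /-- the constraint normals -/
  a : Fin N → EuclideanSpace ℝ (Fin n) → EuclideanSpace ℝ (Fin l)
  /-- the right-hand sides -/
  b : Fin N → EuclideanSpace ℝ (Fin n) → ℝ

namespace ParamPolytope

variable {n l N : ℕ} (P : ParamPolytope n l N)

/-- The polytope `Φ(x)`. -/
def Phi (x : EuclideanSpace ℝ (Fin n)) : Set (EuclideanSpace ℝ (Fin l)) :=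
  {c | ∀ j, inner ℝ (P.a j x) c ≤ P.b j x}

/-- The set of states at which the polytope has nonempty interior. -/
def domainA : Set (EuclideanSpace ℝ (Fin n)) :=
  {x | (interior (P.Phi x)).Nonempty}

/-- The column vector `col(c, r) ∈ ℝ^(l+1)`. -/
def col (c : Fin l → ℝ) (r : ℝ) : Fin (l + 1) → ℝ :=
  Fin.snoc (α := fun _ => ℝ) c r

/-- The cost vector `q = col(0, -1)`. -/
def q (l : ℕ) : Fin (l + 1) → ℝ := col 0 (-1)

/-- The matrix `Ã(x)` of the Chebyshev-ball program: row `0` is `(0, -1)`, and row `j`, for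
`j = 1, …, N`, is `(a_j(x)ᵀ, ‖a_j(x)‖)`, with the Euclidean norm. -/
def Atilde (x : EuclideanSpace ℝ (Fin n)) : Matrix (Fin (N + 1)) (Fin (l + 1)) ℝ :=
  Matrix.of (Fin.cons (α := fun _ => Fin (l + 1) → ℝ) (col 0 (-1))
    (fun j : Fin N => col (fun i => P.a j x i) ‖P.a j x‖))

/-- The vector `b̃(x) = (0, b_1(x), …, b_N(x))`. -/
def btilde (x : EuclideanSpace ℝ (Fin n)) : Fin (N + 1) → ℝ :=
  Fin.cons (α := fun _ => ℝ) 0 (fun j : Fin N => P.b j x)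

/-- The feasible set `F_P(x) = {z | Ã(x) z ≤ b̃(x)}`. -/
def feasible (x : EuclideanSpace ℝ (Fin n)) : Set (Fin (l + 1) → ℝ) :=
  {z | (P.Atilde x).mulVec z ≤ P.btilde x}

/-- The function `h_r(x) = -ε₀ - min {qᵀ z | z ∈ F_P(x)}`. -/
def hr (ε₀ : ℝ) (x : EuclideanSpace ℝ (Fin n)) : ℝ :=
  -ε₀ - sInf ((fun z => dotProduct (q l) z) '' P.feasible x)

/-- The solution map `S(x) = argmin {qᵀ z | z ∈ F_P(x)}`. -/
def solutions (x : EuclideanSpace ℝ (Fin n)) : Set (Fin (l + 1) → ℝ) :=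
  {z | z ∈ P.feasible x ∧ ∀ w ∈ P.feasible x, dotProduct (q l) z ≤ dotProduct (q l) w}

open Classical in
/-- The active index set `J₀(z, x) = {j | ã_j(x)ᵀ z = b̃_j(x)}`. -/
def active (z : Fin (l + 1) → ℝ) (x : EuclideanSpace ℝ (Fin n)) : Finset (Fin (N + 1)) :=
  Finset.univ.filter fun j => dotProduct (P.Atilde x j) z = P.btilde x j

/-- The local Lagrangian `L(μ, z, x) = qᵀ z + ∑_{j ∈ J} μ_j (ã_j(x)ᵀ z - b̃_j(x))`, for a fixed
index set `J`. -/
def lagrangian (J : Finset (Fin (N + 1))) (μ : J → ℝ) (z : Fin (l + 1) → ℝ)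
    (x : EuclideanSpace ℝ (Fin n)) : ℝ :=
  dotProduct (q l) z + ∑ j : J, μ j * (dotProduct (P.Atilde x j) z - P.btilde x j)

/-- The row vector (linear functional)
`∂ₓL(μ, z, x) = ∑_{j ∈ J₀(z, x)} μ_j (zᵀ (∂ã_j/∂x)(x) - (∂b̃_j/∂x)(x))`. -/
def dxL (z : Fin (l + 1) → ℝ) (x : EuclideanSpace ℝ (Fin n)) (μ : P.active z x → ℝ) :
    EuclideanSpace ℝ (Fin n) →L[ℝ] ℝ :=
  ∑ j : P.active z x, μ j •
    ((∑ i : Fin (l + 1), z i • ContinuousLinearMap.proj (R := ℝ) (φ := fun _ => ℝ) i).comp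
        (fderiv ℝ (fun y => P.Atilde y j) x)
      - fderiv ℝ (fun y => P.btilde y j) x)

/-- The active matrix `Ã_{J₀(z, x)}(x)`, made of the active rows of `Ã(x)`. -/
def activeMatrix (z : Fin (l + 1) → ℝ) (x : EuclideanSpace ℝ (Fin n)) :
    Matrix (P.active z x) (Fin (l + 1)) ℝ :=
  Matrix.of fun j => P.Atilde x j

/-- The multiplier set `M(z, x) = {μ | Ã_{J₀(z, x)}(x)ᵀ μ = -q, μ ≥ 0}`. -/
def multipliers (z : Fin (l + 1) → ℝ) (x : EuclideanSpace ℝ (Fin n)) :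
    Set (P.active z x → ℝ) :=
  {μ | (P.activeMatrix z x).transpose.mulVec μ = -q l ∧ 0 ≤ μ}

end ParamPolytope

/-- `h`, regarded as a function on the set `A`, has the one-sided directional derivative `v` at `x`
along `d`: the points `x + σ d` lie in `A` for all small `σ > 0`, and
`(h(x + σ d) - h(x)) / σ → v` as `σ → 0⁺`. -/
def HasDirDerivOn {n : ℕ} (A : Set (EuclideanSpace ℝ (Fin n)))
    (h : EuclideanSpace ℝ (Fin n) → ℝ) (x d : EuclideanSpace ℝ (Fin n)) (v : ℝ) : Prop :=
  (∀ᶠ σ in 𝓝[>] (0 : ℝ), x + σ • d ∈ A) ∧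
    Filter.Tendsto (fun σ : ℝ => (h (x + σ • d) - h x) / σ) (𝓝[>] (0 : ℝ)) (𝓝 v)

end

/-!
The derivative formula is Gol'shtein's theorem for the value of a linear program whose data are
differentiable in a parameter, under Slater's condition. At a point of the domain a ball of positive
radius fits into the polytope, so the program `min {qᵀ z | Ã(x) z ≤ b̃(x)}` has a strictly feasible
point (`exists_strict_feasible`); this persists nearby, and the feasible sets are uniformly bounded,
so that the perturbed programs along the ray `x + t d` have solutions `z_t`. The Slater point also
bounds the multipliers.

One bound on the optimal value is primal. At an optimal `z`, linearise the active constraints in `t`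
and `z`. By a separation argument (`exists_descent_or_exists_multiplier`), either some multiplier
`μ ∈ M(z, x)` satisfies `∂ₓL(μ, z, x) d ≥ γ`, or there is a direction `w` with `qᵀ w < γ` that
satisfies the linearised constraints strictly, and then `z + t w` is feasible at `x + t d` for small
`t > 0`. Hence the quotients of the value are asymptotically at most `max_μ ∂ₓL(μ, z, x) d`.
The same alternative with `d = 0` shows that `M(z, x)` is nonempty for optimal `z`.

The other bound is dual. Along an ultrafilter of `t → 0⁺` the solutions `z_t` converge to some `z`,
which is again a solution (`mem_solutions_of_tendsto`), and weak duality with any `μ ∈ M(z, x)` shows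
that the quotients are asymptotically at least `∂ₓL(μ, z, x) d` (`exists_tendsto_le_of_multiplier`).
The two bounds meet at this `z`, which therefore attains the outer maximum, and the common value
does not depend on the ultrafilter (`exists_isGreatest_and_tendsto`).
-/

open Filter

/-! ### Theorems of the alternative and multiplier sets -/

/-- A theorem of the alternative for strict inequalities: either the affine system
`c i ⬝ᵥ w + g i < 0` is solvable, or a nonzero nonnegative combination of it is a contradiction.
The multiplier is a hyperplane separating `0` from the open convex set of all `y` that strictly
dominate some `(c i ⬝ᵥ w + g i)_i`. -/
theorem exists_strict_solution_or_exists_multiplier {ι κ : Type*} [Fintype ι] [Fintype κ]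
    (c : ι → κ → ℝ) (g : ι → ℝ) :
    (∃ w : κ → ℝ, ∀ i, c i ⬝ᵥ w + g i < 0) ∨
      ∃ μ : ι → ℝ, 0 ≤ μ ∧ μ ≠ 0 ∧ ∑ i, μ i • c i = 0 ∧ 0 ≤ ∑ i, μ i * g i := by
  classical
  by_cases hw : ∃ w : κ → ℝ, ∀ i, c i ⬝ᵥ w + g i < 0
  · exact Or.inl hw
  right
  set C : Set (ι → ℝ) := {y | ∃ w : κ → ℝ, ∀ i, c i ⬝ᵥ w + g i < y i} with hC
  have hconv : Convex ℝ C := by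
    rintro y ⟨w, hy⟩ y' ⟨w', hy'⟩ s t hs ht hst
    refine ⟨s • w + t • w', fun i => ?_⟩
    have h1 := hy i
    have h2 := hy' i
    simp only [dotProduct_add, dotProduct_smul, smul_eq_mul, Pi.add_apply, Pi.smul_apply]
    have hg : g i = s * g i + t * g i := by rw [← add_mul, hst, one_mul]
    rcases hs.eq_or_lt with rfl | hs'
    · have : t = 1 := by linarith
      subst this
      linarith
    · nlinarith [mul_lt_mul_of_pos_left h1 hs', mul_le_mul_of_nonneg_left h2.le ht]
  have hopen : IsOpen C := by
    have : C = ⋃ w : κ → ℝ, {y | ∀ i, c i ⬝ᵥ w + g i < y i} := by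
      ext y; simp [hC]
    rw [this]
    refine isOpen_iUnion fun w => ?_
    simp only [Set.ofPred_forall]
    exact isOpen_iInter_of_finite fun i => isOpen_lt continuous_const (continuous_apply i)
  have h0 : (0 : ι → ℝ) ∉ C := fun ⟨w, h⟩ => hw ⟨w, h⟩
  obtain ⟨f, hf⟩ := geometric_hahn_banach_open_point hconv hopen h0
  have hrep : ∀ y : ι → ℝ, f y = ∑ i, y i * f (Pi.single i 1) := fun y => by
    conv_lhs => rw [pi_eq_sum_univ' y]
    simp [map_sum]
  set μ : ι → ℝ := fun i => -f (Pi.single i 1) with hμ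
  have hpos : ∀ y ∈ C, 0 < ∑ i, μ i * y i := fun y hy => by
    have h := hf y hy
    rw [map_zero, hrep] at h
    have : ∑ i, μ i * y i = -∑ i, y i * f (Pi.single i 1) := by
      rw [← Finset.sum_neg_distrib]
      exact Finset.sum_congr rfl fun i _ => by simp only [hμ]; ring
    linarith
  have hC0 : (fun i => g i + 1) ∈ C := ⟨0, fun i => by simp⟩
  have hle : ∀ w : κ → ℝ, 0 ≤ ∑ i, μ i * (c i ⬝ᵥ w + g i) := fun w => by
    by_contra hneg
    push Not at hneg
    have hlim : Tendsto (fun ε : ℝ => ∑ i, μ i * (c i ⬝ᵥ w + g i + ε)) (𝓝[>] 0)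
        (𝓝 (∑ i, μ i * (c i ⬝ᵥ w + g i + 0))) :=
      (Continuous.tendsto (by fun_prop) 0).mono_left nhdsWithin_le_nhds
    have h := ge_of_tendsto (b := (0 : ℝ)) hlim (by
      filter_upwards [self_mem_nhdsWithin] with ε hε
      exact (hpos _ ⟨w, fun i => lt_add_of_pos_right _ hε⟩).le)
    simp only [add_zero] at h
    linarith
  have hexp : ∀ w : κ → ℝ, ∑ i, μ i * (c i ⬝ᵥ w + g i) =
      (∑ i, μ i • c i) ⬝ᵥ w + ∑ i, μ i * g i := fun w => by
    simp only [sum_dotProduct, smul_dotProduct, smul_eq_mul, mul_add, Finset.sum_add_distrib]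
  refine ⟨μ, fun i => ?_, ?_, ?_, ?_⟩
  · by_contra hneg
    simp only [Pi.zero_apply, not_le] at hneg
    set T := ∑ j, μ j * (g j + 1) with hT
    have hT0 : 0 < T := hpos _ hC0
    -- moving far enough along the `i`-th axis stays in `C` but makes the functional vanish
    have h := hpos (fun j => g j + 1 + Pi.single (M := fun _ => ℝ) i (T / -μ i) j) ⟨0, fun j => by
      have : 0 ≤ Pi.single (M := fun _ => ℝ) i (T / -μ i) j := by
        rw [Pi.single_apply]
        split_ifs
        · exact (div_pos hT0 (neg_pos.2 hneg)).le
        · exact le_rfl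
      simp only [dotProduct_zero]
      linarith⟩
    simp only [mul_add, Finset.sum_add_distrib, Pi.single_apply, mul_ite, mul_zero,
      Finset.sum_ite_eq', Finset.mem_univ, if_true] at h
    simp only [mul_add, Finset.sum_add_distrib] at hT
    rw [← hT] at h
    have : μ i * (T / -μ i) = -T := by
      have := hneg.ne
      field_simp
    linarith
  · intro h
    have := hpos _ hC0
    simp [h] at this
  · -- an affine function that is bounded below has no linear part
    by_contra hne
    set v := ∑ i, μ i • c i with hv
    have hvv : 0 < v ⬝ᵥ v := by
      have := dotProduct_self_eq_zero (v := v)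
      have h' : 0 ≤ v ⬝ᵥ v := Finset.sum_nonneg fun i _ => mul_self_nonneg _
      exact h'.lt_of_ne fun h => hne (this.1 h.symm)
    have h := hle (-((∑ i, μ i * g i + 1) / (v ⬝ᵥ v)) • v)
    rw [hexp, dotProduct_smul, smul_eq_mul, neg_mul, div_mul_cancel₀ _ hvv.ne'] at h
    linarith
  · have h := hle 0
    rw [hexp] at h
    simpa using h

/-- Duality for the linearised program `min {q ⬝ᵥ w | c i ⬝ᵥ w + g i ≤ 0}` under Slater's
condition, which here is the existence of a direction `u` of strict decrease of all constraints: a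
level `γ` is either beaten by a strictly feasible `w`, or certified by a multiplier. -/
theorem exists_descent_or_exists_multiplier {ι κ : Type*} [Fintype ι] [Fintype κ]
    (c : ι → κ → ℝ) (g : ι → ℝ) (q : κ → ℝ) (γ : ℝ) {u : κ → ℝ} (hu : ∀ i, c i ⬝ᵥ u < 0) :
    (∃ w : κ → ℝ, (∀ i, c i ⬝ᵥ w + g i < 0) ∧ q ⬝ᵥ w < γ) ∨
      ∃ μ : ι → ℝ, 0 ≤ μ ∧ ∑ i, μ i • c i = -q ∧ γ ≤ ∑ i, μ i * g i := by
  rcases exists_strict_solution_or_exists_multiplier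
    (fun o : Option ι => o.elim q c) (fun o => o.elim (-γ) g) with ⟨w, hw⟩ | ⟨ν, hν, hne, hs, hg⟩
  · refine Or.inl ⟨w, fun i => hw (some i), ?_⟩
    have := hw none
    simp only [Option.elim] at this
    linarith
  right
  simp only [Fintype.sum_option, Option.elim] at hs hg
  have hν0 : 0 < ν none := by
    refine (hν none).lt_of_ne fun h => hne ?_
    simp only [Pi.zero_apply] at h
    rw [← h, zero_smul, zero_add] at hs
    -- with no weight on the cost, Slater's direction forces every weight to vanish
    have h1 : ∑ i, ν (some i) * (c i ⬝ᵥ u) = 0 := by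
      have := congrArg (· ⬝ᵥ u) hs
      simpa [sum_dotProduct, smul_dotProduct] using this
    have h2 := (Finset.sum_eq_zero_iff_of_nonpos fun i _ =>
      mul_nonpos_of_nonneg_of_nonpos (hν (some i)) (hu i).le).1 h1
    funext o
    cases o with
    | none => exact h.symm
    | some i => exact (mul_eq_zero.1 (h2 i (Finset.mem_univ i))).resolve_right (hu i).ne
  refine ⟨fun i => (ν none)⁻¹ * ν (some i),
    fun i => mul_nonneg (inv_nonneg.2 hν0.le) (hν (some i)), ?_, ?_⟩
  · simp only [mul_smul, ← Finset.smul_sum]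
    rw [eq_neg_of_add_eq_zero_right hs, smul_neg, smul_smul, inv_mul_cancel₀ hν0.ne', one_smul]
  · simp only [mul_assoc, ← Finset.mul_sum]
    rw [inv_mul_eq_div, le_div_iff₀ hν0]
    linarith

theorem isCompact_setOf_multiplier {ι κ : Type*} [Fintype ι] [Fintype κ]
    (c : ι → κ → ℝ) (q : κ → ℝ) {u : κ → ℝ} (hu : ∀ i, c i ⬝ᵥ u < 0) :
    IsCompact {μ : ι → ℝ | ∑ i, μ i • c i = -q ∧ 0 ≤ μ} := by
  have hclosed : IsClosed {μ : ι → ℝ | ∑ i, μ i • c i = -q ∧ 0 ≤ μ} :=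
    (isClosed_eq (by fun_prop) continuous_const).inter isClosed_Ici
  refine (isCompact_Icc (a := (0 : ι → ℝ))
    (b := fun i => q ⬝ᵥ u / -(c i ⬝ᵥ u))).of_isClosed_subset hclosed ?_
  rintro μ ⟨hμ, h0⟩
  refine ⟨h0, fun i => ?_⟩
  rw [le_div_iff₀ (neg_pos.2 (hu i))]
  have h1 : ∑ i, μ i * -(c i ⬝ᵥ u) = q ⬝ᵥ u := by
    have := congrArg (· ⬝ᵥ u) hμ
    simp only [sum_dotProduct, smul_dotProduct, neg_dotProduct, smul_eq_mul] at this
    simp only [mul_neg, Finset.sum_neg_distrib, this, neg_neg]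
  rw [← h1]
  exact Finset.single_le_sum (f := fun i => μ i * -(c i ⬝ᵥ u))
    (fun j _ => mul_nonneg (h0 j) (neg_pos.2 (hu j)).le) (Finset.mem_univ i)

/-! ### Linear programs along a ray -/

/-- A direction `w` that strictly satisfies the linearisation of the active constraints at a
feasible point `z` keeps `z + t w` feasible for the perturbed constraints, for small `t > 0`. -/
theorem eventually_feasible_of_strict {ι κ : Type*} [Finite ι] [Fintype κ]
    {A : ℝ → ι → κ → ℝ} {b : ℝ → ι → ℝ} {A' : ι → κ → ℝ} {b' : ι → ℝ}
    (hA : ∀ i, HasDerivAt (fun t => A t i) (A' i) 0)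
    (hb : ∀ i, HasDerivAt (fun t => b t i) (b' i) 0) {z w : κ → ℝ}
    (hz : ∀ i, A 0 i ⬝ᵥ z ≤ b 0 i)
    (hw : ∀ i, A 0 i ⬝ᵥ z = b 0 i → A 0 i ⬝ᵥ w + (A' i ⬝ᵥ z - b' i) < 0) :
    ∀ᶠ t in 𝓝[>] (0 : ℝ), ∀ i, A t i ⬝ᵥ (z + t • w) ≤ b t i := by
  rw [eventually_all]
  intro i
  have hder : HasDerivAt (fun t => A t i ⬝ᵥ (z + t • w) - b t i)
      (A 0 i ⬝ᵥ w + (A' i ⬝ᵥ z - b' i)) 0 := by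
    have hzw : ∀ k, HasDerivAt (fun t : ℝ => z k + t * w k) (w k) 0 := fun k => by
      simpa using ((hasDerivAt_id (0 : ℝ)).mul_const (w k)).const_add (z k)
    have h := (HasDerivAt.fun_sum fun k (_ : k ∈ Finset.univ) =>
      (hasDerivAt_pi.1 (hA i) k).mul (hzw k)).sub (hb i)
    refine h.congr_deriv ?_
    simp only [dotProduct, Finset.sum_add_distrib, zero_mul, add_zero]
    ring
  rcases (hz i).eq_or_lt with heq | hlt
  · have hs := (hasDerivAt_iff_tendsto_slope.1 hder).mono_left
      (nhdsWithin_mono 0 fun t (ht : 0 < t) => ht.ne')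
    filter_upwards [hs.eventually_lt_const (hw i heq), self_mem_nhdsWithin] with t ht ht0
    rw [slope_def_field] at ht
    have ht0' : (0 : ℝ) < t := ht0
    simp only [zero_smul, add_zero, heq, sub_self, sub_zero] at ht
    by_contra! hgt
    exact absurd ht (not_lt.2 (div_nonneg (sub_nonneg.2 hgt.le) ht0'.le))
  · have hc := hder.continuousAt.tendsto
    simp only [zero_smul, add_zero] at hc
    filter_upwards [(hc.eventually_lt_const (sub_neg.2 hlt)).filter_mono nhdsWithin_le_nhds]
      with t ht
    linarith

/-- Weak duality along a ray: if feasible points `zt t` of the perturbed programs converge to `z`,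
then a multiplier `μ` for the constraints `i : ι`, all of them active at `z`, bounds the difference
quotients of the cost below, asymptotically, by the derivative of the Lagrangian. -/
theorem exists_tendsto_le_of_multiplier {ι κ : Type*} [Fintype ι] [Fintype κ]
    {A : ℝ → ι → κ → ℝ} {b : ℝ → ι → ℝ} {A' : ι → κ → ℝ} {b' : ι → ℝ}
    (hA : ∀ i, HasDerivAt (fun t => A t i) (A' i) 0)
    (hb : ∀ i, HasDerivAt (fun t => b t i) (b' i) 0) {q z : κ → ℝ} {μ : ι → ℝ}
    (hz : ∀ i, A 0 i ⬝ᵥ z = b 0 i) (hμ0 : 0 ≤ μ) (hμ : ∑ i, μ i • A 0 i = -q)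
    {U : Filter ℝ} (hU : U ≤ 𝓝[>] 0) {zt : ℝ → κ → ℝ} (hzt : Tendsto zt U (𝓝 z))
    (hfeas : ∀ᶠ t in U, ∀ i, A t i ⬝ᵥ zt t ≤ b t i) :
    ∃ ψ : ℝ → ℝ, Tendsto ψ U (𝓝 (∑ i, μ i * (A' i ⬝ᵥ z - b' i))) ∧
      ∀ᶠ t in U, ψ t ≤ (q ⬝ᵥ zt t - q ⬝ᵥ z) / t := by
  have hU' : U ≤ 𝓝[≠] 0 := hU.trans (nhdsWithin_mono 0 fun t (ht : 0 < t) => ht.ne')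
  refine ⟨fun t => ∑ i, μ i * (slope (fun t => A t i) 0 t ⬝ᵥ zt t - slope (fun t => b t i) 0 t),
    ?_, ?_⟩
  · refine tendsto_finsetSum _ fun i _ => Tendsto.const_mul _ (Tendsto.sub ?_
      ((hasDerivAt_iff_tendsto_slope.1 (hb i)).mono_left hU'))
    have h := (hasDerivAt_iff_tendsto_slope.1 (hA i)).mono_left hU'
    exact tendsto_finsetSum _ fun k _ => (tendsto_pi_nhds.1 h k).mul (tendsto_pi_nhds.1 hzt k)
  · filter_upwards [hfeas, hU self_mem_nhdsWithin] with t ht ht0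
    have ht0' : (0 : ℝ) < t := ht0
    rw [le_div_iff₀ ht0', Finset.sum_mul]
    have hq : ∀ y : κ → ℝ, q ⬝ᵥ y = -∑ i, μ i * (A 0 i ⬝ᵥ y) := fun y => by
      rw [← neg_neg q, ← hμ]
      simp [sum_dotProduct, smul_dotProduct]
    rw [hq, hq, ← sub_nonneg, neg_sub_neg, ← Finset.sum_sub_distrib, ← Finset.sum_sub_distrib]
    refine Finset.sum_nonneg fun i _ => ?_
    have h1 : slope (fun t => A t i) 0 t ⬝ᵥ zt t * t = A t i ⬝ᵥ zt t - A 0 i ⬝ᵥ zt t := by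
      rw [slope_def_module, smul_dotProduct, sub_dotProduct, sub_zero, smul_eq_mul]
      field_simp
    have h2 : slope (fun t => b t i) 0 t * t = b t i - b 0 i := by
      rw [slope_def_field, sub_zero]
      field_simp
    have h3 := mul_nonneg (hμ0 i) (sub_nonneg.2 (ht i))
    have h4 : μ i * (slope (fun t => A t i) 0 t ⬝ᵥ zt t - slope (fun t => b t i) 0 t) * t =
        μ i * (slope (fun t => A t i) 0 t ⬝ᵥ zt t * t - slope (fun t => b t i) 0 t * t) := by
      ring
    rw [h4, h1, h2, hz i]
    nlinarith

/-- If every value of `m` on `S` is an asymptotic lower bound of `D`, and along every finer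
ultrafilter some value of `m` on `S` is an asymptotic upper bound, then `m` has a maximum on `S`
and `D` tends to it. -/
theorem exists_isGreatest_and_tendsto {α β : Type*} {F : Filter α} [F.NeBot] {D : α → ℝ}
    {S : Set β} {m : β → ℝ} (hlow : ∀ z ∈ S, ∀ r < m z, ∀ᶠ t in F, r ≤ D t)
    (hup : ∀ U : Ultrafilter α, ↑U ≤ F → ∃ z ∈ S, ∀ r > m z, ∀ᶠ t in (U : Filter α), D t ≤ r) :
    ∃ v, IsGreatest (m '' S) v ∧ Tendsto D F (𝓝 v) := by
  have hmax : ∀ U : Ultrafilter α, ↑U ≤ F → ∃ z ∈ S, IsGreatest (m '' S) (m z) ∧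
      Tendsto D U (𝓝 (m z)) := by
    intro U hU
    obtain ⟨z, hz, h⟩ := hup U hU
    refine ⟨z, hz, ⟨⟨z, hz, rfl⟩, ?_⟩, ?_⟩
    · rintro _ ⟨y, hy, rfl⟩
      by_contra! hlt
      obtain ⟨r, hr1, hr2⟩ := exists_between hlt
      obtain ⟨s, hs1, hs2⟩ := exists_between hr2
      obtain ⟨t, ht1, ht2⟩ := ((h r hr1).and ((hlow y hy s hs2).filter_mono hU)).exists
      linarith
    · refine tendsto_order.2 ⟨fun r hr => ?_, fun r hr => ?_⟩
      · obtain ⟨s, hs1, hs2⟩ := exists_between hr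
        exact ((hlow z hz s hs2).filter_mono hU).mono fun t ht => hs1.trans_le ht
      · obtain ⟨s, hs1, hs2⟩ := exists_between hr
        exact (h s hs1).mono fun t ht => ht.trans_lt hs2
  obtain ⟨z, hz, hgr, -⟩ := hmax (Ultrafilter.of F) (Ultrafilter.of_le F)
  refine ⟨m z, hgr, tendsto_iff_ultrafilter _ _ _ |>.2 fun U hU => ?_⟩
  obtain ⟨y, hy, hgr', hlim⟩ := hmax U hU
  rwa [hgr'.unique hgr] at hlim

/-! ### The Chebyshev-ball program -/

namespace ParamPolytope

variable {n l N : ℕ} {P : ParamPolytope n l N}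

theorem col_dotProduct (c : Fin l → ℝ) (r : ℝ) (z : Fin (l + 1) → ℝ) :
    col c r ⬝ᵥ z = ∑ i, c i * z i.castSucc + r * z (Fin.last l) := by
  simp [dotProduct, col, Fin.sum_univ_castSucc]

theorem q_dotProduct (z : Fin (l + 1) → ℝ) : q l ⬝ᵥ z = -z (Fin.last l) := by
  simp [q, col_dotProduct]

/-- The centre of the ball encoded by `z = col(c, r)`. -/
def center (z : Fin (l + 1) → ℝ) : EuclideanSpace ℝ (Fin l) :=
  WithLp.toLp 2 fun i => z i.castSucc

theorem Atilde_zero_dotProduct (x : EuclideanSpace ℝ (Fin n)) (z : Fin (l + 1) → ℝ) :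
    P.Atilde x 0 ⬝ᵥ z = -z (Fin.last l) := by
  have h : P.Atilde x 0 = col 0 (-1) := rfl
  simp [h, col_dotProduct]

theorem Atilde_succ_dotProduct (x : EuclideanSpace ℝ (Fin n)) (j : Fin N)
    (z : Fin (l + 1) → ℝ) :
    P.Atilde x j.succ ⬝ᵥ z = inner ℝ (P.a j x) (center z) + ‖P.a j x‖ * z (Fin.last l) := by
  have h : P.Atilde x j.succ = col (fun i => P.a j x i) ‖P.a j x‖ := rfl
  simp [h, col_dotProduct, center, PiLp.inner_apply, mul_comm]

theorem mem_feasible_iff {x : EuclideanSpace ℝ (Fin n)} {z : Fin (l + 1) → ℝ} :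
    z ∈ P.feasible x ↔ ∀ j, P.Atilde x j ⬝ᵥ z ≤ P.btilde x j :=
  Iff.rfl

theorem mem_feasible_iff' {x : EuclideanSpace ℝ (Fin n)} {z : Fin (l + 1) → ℝ} :
    z ∈ P.feasible x ↔ 0 ≤ z (Fin.last l) ∧
      ∀ j, inner ℝ (P.a j x) (center z) + ‖P.a j x‖ * z (Fin.last l) ≤ P.b j x := by
  rw [mem_feasible_iff, Fin.forall_fin_succ, Atilde_zero_dotProduct]
  simp only [Atilde_succ_dotProduct, btilde, Fin.cons_zero, Fin.cons_succ]
  rw [neg_nonpos]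

/-- A feasible pair encodes a ball that is contained in the polytope. -/
theorem closedBall_subset_Phi {x : EuclideanSpace ℝ (Fin n)} {z : Fin (l + 1) → ℝ}
    (hz : z ∈ P.feasible x) : Metric.closedBall (center z) (z (Fin.last l)) ⊆ P.Phi x := by
  intro c hc j
  have h := (mem_feasible_iff'.1 hz).2 j
  rw [mem_closedBall_iff_norm] at hc
  have h1 := real_inner_le_norm (P.a j x) (c - center z)
  rw [inner_sub_right] at h1
  have h2 := mul_le_mul_of_nonneg_left hc (norm_nonneg (P.a j x))
  linarith

/-- Slater's condition holds at the points of the domain. -/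
theorem exists_strict_feasible {x : EuclideanSpace ℝ (Fin n)} (ha_ne : ∀ j, P.a j x ≠ 0)
    (hx : x ∈ P.domainA) : ∃ z, ∀ j, P.Atilde x j ⬝ᵥ z < P.btilde x j := by
  obtain ⟨c, hc⟩ := hx
  obtain ⟨ρ, hρ, hball⟩ := Metric.nhds_basis_closedBall.mem_iff.1 (mem_interior_iff_mem_nhds.1 hc)
  refine ⟨col c (ρ / 2), Fin.cases ?_ fun j => ?_⟩
  · rw [Atilde_zero_dotProduct]
    simpa [col, btilde] using hρ
  · rw [Atilde_succ_dotProduct]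
    have hn : 0 < ‖P.a j x‖ := norm_pos_iff.2 (ha_ne j)
    -- the point of the ball that lies farthest in the direction `a_j(x)`
    have h := hball (show c + (ρ / ‖P.a j x‖) • P.a j x ∈ _ by
      rw [mem_closedBall_iff_norm, add_sub_cancel_left, norm_smul, Real.norm_eq_abs,
        abs_of_pos (div_pos hρ hn), div_mul_cancel₀ _ hn.ne']) j
    have hc' : center (col (fun i => c i) (ρ / 2)) = c := by
      ext i
      simp [center, col]
    have hr : col (fun i => c i) (ρ / 2) (Fin.last l) = ρ / 2 := by simp [col]
    rw [inner_add_right, inner_smul_right, real_inner_self_eq_norm_sq, div_mul_eq_mul_div, sq,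
      ← mul_assoc, mul_div_assoc, div_self hn.ne', mul_one] at h
    rw [hc', hr]
    simp only [btilde, Fin.cons_succ]
    nlinarith

theorem mem_domainA_of_strict {x : EuclideanSpace ℝ (Fin n)} {z : Fin (l + 1) → ℝ}
    (hz : ∀ j, P.Atilde x j ⬝ᵥ z < P.btilde x j) : x ∈ P.domainA := by
  have hpos : 0 < z (Fin.last l) := by
    have := hz 0
    rw [Atilde_zero_dotProduct] at this
    simpa [btilde] using this
  exact ⟨center z, mem_interior_iff_mem_nhds.2 (mem_of_superset
    (Metric.closedBall_mem_nhds _ hpos) (closedBall_subset_Phi fun j => (hz j).le))⟩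

/-- If the polytopes are uniformly bounded then so are the feasible sets: the radius is bounded
because the ball reaches a point `c + e` of the polytope with `‖e‖ = r`, where `e` is a multiple of
some `a_j(x) ≠ 0`. -/
theorem exists_feasible_subset_closedBall (hN : 1 ≤ N) (ha_ne : ∀ j x, P.a j x ≠ 0)
    (hbdd : ∃ D : Set (EuclideanSpace ℝ (Fin l)), IsCompact D ∧ ∀ x, P.Phi x ⊆ D) :
    ∃ R, ∀ x, P.feasible x ⊆ Metric.closedBall 0 R := by
  obtain ⟨D, hD, hsub⟩ := hbdd
  obtain ⟨R, hR⟩ := hD.isBounded.subset_closedBall 0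
  refine ⟨2 * R, fun x z hz => ?_⟩
  have h0 := (mem_feasible_iff'.1 hz).1
  have hball : ∀ c ∈ Metric.closedBall (center z) (z (Fin.last l)), ‖c‖ ≤ R := fun c hc =>
    mem_closedBall_zero_iff.1 (hR (hsub x (closedBall_subset_Phi hz hc)))
  have hc := hball _ (Metric.mem_closedBall_self h0)
  have hR0 : 0 ≤ R := (norm_nonneg _).trans hc
  have hn : 0 < ‖P.a ⟨0, hN⟩ x‖ := norm_pos_iff.2 (ha_ne _ x)
  set e : EuclideanSpace ℝ (Fin l) := (z (Fin.last l) / ‖P.a ⟨0, hN⟩ x‖) • P.a ⟨0, hN⟩ x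
  have he : ‖e‖ = z (Fin.last l) := by
    rw [norm_smul, Real.norm_eq_abs, abs_of_nonneg (div_nonneg h0 hn.le), div_mul_cancel₀ _ hn.ne']
  have hc' := hball (center z + e) (by rw [mem_closedBall_iff_norm, add_sub_cancel_left, he])
  rw [mem_closedBall_zero_iff, pi_norm_le_iff_of_nonneg (by positivity)]
  refine Fin.lastCases ?_ fun i => ?_
  · rw [Real.norm_eq_abs, abs_of_nonneg h0, ← he]
    have := norm_sub_le (center z + e) (center z)
    rw [add_sub_cancel_left] at this
    linarith
  · have := PiLp.norm_apply_le (center z) i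
    simp only [center] at this hc
    linarith

theorem isClosed_feasible (x : EuclideanSpace ℝ (Fin n)) : IsClosed (P.feasible x) :=
  isClosed_le (Continuous.matrix_mulVec continuous_const continuous_id) continuous_const

theorem solutions_nonempty {x : EuclideanSpace ℝ (Fin n)} {R : ℝ} (ha_ne : ∀ j, P.a j x ≠ 0)
    (hR : P.feasible x ⊆ Metric.closedBall 0 R) (hx : x ∈ P.domainA) :
    (P.solutions x).Nonempty := by
  obtain ⟨z, hz⟩ := exists_strict_feasible ha_ne hx
  obtain ⟨w, hw, hmin⟩ := ((isCompact_closedBall _ _).of_isClosed_subset (isClosed_feasible x)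
    hR).exists_isMinOn ⟨z, fun j => (hz j).le⟩ (f := fun z => q l ⬝ᵥ z)
    (by simp only [q_dotProduct]; fun_prop)
  exact ⟨w, hw, fun y hy => hmin hy⟩

theorem hr_eq {ε₀ : ℝ} {x : EuclideanSpace ℝ (Fin n)} {z : Fin (l + 1) → ℝ}
    (hz : z ∈ P.solutions x) : P.hr ε₀ x = -ε₀ - q l ⬝ᵥ z := by
  have : IsLeast ((fun z => q l ⬝ᵥ z) '' P.feasible x) (q l ⬝ᵥ z) :=
    ⟨⟨z, hz.1, rfl⟩, by rintro _ ⟨w, hw, rfl⟩; exact hz.2 w hw⟩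
  rw [hr, this.csInf_eq]

theorem differentiable_Atilde (ha : ∀ j, ContDiff ℝ 1 (P.a j)) (ha_ne : ∀ j x, P.a j x ≠ 0)
    (j : Fin (N + 1)) : Differentiable ℝ fun y => P.Atilde y j := by
  intro x
  rw [differentiableAt_pi]
  refine Fin.cases (fun i => differentiableAt_const _) (fun j => ?_) j
  have hj : DifferentiableAt ℝ (P.a j) x := (ha j).differentiable one_ne_zero x
  refine Fin.lastCases ?_ fun i => ?_
  · simpa [Atilde, col] using hj.norm ℝ (ha_ne j x)
  · simpa [Atilde, col] using (differentiableAt_piLp 2).1 hj i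

theorem differentiable_btilde (hb : ∀ j, ContDiff ℝ 1 (P.b j)) (j : Fin (N + 1)) :
    Differentiable ℝ fun y => P.btilde y j := by
  refine Fin.cases (differentiable_const _) (fun j => ?_) j
  simpa [btilde] using (hb j).differentiable one_ne_zero

theorem isOpen_domainA (ha : ∀ j, ContDiff ℝ 1 (P.a j)) (hb : ∀ j, ContDiff ℝ 1 (P.b j))
    (ha_ne : ∀ j x, P.a j x ≠ 0) : IsOpen P.domainA := by
  refine isOpen_iff_mem_nhds.2 fun x hx => ?_
  obtain ⟨z, hz⟩ := exists_strict_feasible (fun j => ha_ne j x) hx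
  have hc : ∀ j, Continuous fun y => P.Atilde y j ⬝ᵥ z := fun j =>
    continuous_finsetSum _ fun i _ =>
      ((continuous_apply i).comp (differentiable_Atilde ha ha_ne j).continuous).mul_const (z i)
  have : ∀ᶠ y in 𝓝 x, ∀ j, P.Atilde y j ⬝ᵥ z < P.btilde y j :=
    eventually_all.2 fun j =>
      (hc j).continuousAt.eventually_lt (differentiable_btilde hb j).continuous.continuousAt (hz j)
  exact this.mono fun y hy => mem_domainA_of_strict hy

/-! ### Multipliers and the local Lagrangian -/

theorem mem_active {z : Fin (l + 1) → ℝ} {x : EuclideanSpace ℝ (Fin n)} {j : Fin (N + 1)} :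
    j ∈ P.active z x ↔ P.Atilde x j ⬝ᵥ z = P.btilde x j := by
  simp [active]

theorem multipliers_eq (z : Fin (l + 1) → ℝ) (x : EuclideanSpace ℝ (Fin n)) :
    P.multipliers z x =
      {μ | ∑ j : P.active z x, μ j • P.Atilde x (j : Fin (N + 1)) = -q l ∧ 0 ≤ μ} := by
  ext μ
  have : (P.activeMatrix z x).transpose.mulVec μ =
      ∑ j : P.active z x, μ j • P.Atilde x (j : Fin (N + 1)) := by
    ext i
    simp [Matrix.mulVec, dotProduct, activeMatrix, Finset.sum_apply, mul_comm]
  change _ = _ ∧ _ ↔ _ = _ ∧ _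
  rw [this]

/-- Moving from `z` towards a Slater point strictly decreases the constraints active at `z`. -/
theorem exists_active_descent {x : EuclideanSpace ℝ (Fin n)} (ha_ne : ∀ j, P.a j x ≠ 0)
    (hx : x ∈ P.domainA) (z : Fin (l + 1) → ℝ) :
    ∃ u, ∀ j : P.active z x, P.Atilde x (j : Fin (N + 1)) ⬝ᵥ u < 0 := by
  obtain ⟨w, hw⟩ := exists_strict_feasible ha_ne hx
  refine ⟨w - z, fun j => ?_⟩
  rw [dotProduct_sub, mem_active.1 j.2, sub_neg]
  exact hw j

theorem isCompact_multipliers {x : EuclideanSpace ℝ (Fin n)} (ha_ne : ∀ j, P.a j x ≠ 0)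
    (hx : x ∈ P.domainA) (z : Fin (l + 1) → ℝ) : IsCompact (P.multipliers z x) := by
  obtain ⟨u, hu⟩ := exists_active_descent ha_ne hx z
  rw [multipliers_eq]
  exact isCompact_setOf_multiplier (fun j : P.active z x => P.Atilde x (j : Fin (N + 1))) (q l) hu

theorem dxL_apply (z : Fin (l + 1) → ℝ) (x d : EuclideanSpace ℝ (Fin n))
    (μ : P.active z x → ℝ) :
    P.dxL z x μ d = ∑ j : P.active z x,
      μ j * (fderiv ℝ (fun y => P.Atilde y (j : Fin (N + 1))) x d ⬝ᵥ z -
        fderiv ℝ (fun y => P.btilde y (j : Fin (N + 1))) x d) := by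
  simp [dxL, dotProduct, mul_comm]

theorem hasFDerivAt_lagrangian_state (ha : ∀ j, ContDiff ℝ 1 (P.a j))
    (hb : ∀ j, ContDiff ℝ 1 (P.b j)) (ha_ne : ∀ j x, P.a j x ≠ 0) (z : Fin (l + 1) → ℝ)
    (x : EuclideanSpace ℝ (Fin n)) (μ : P.active z x → ℝ) :
    HasFDerivAt (fun y => P.lagrangian (P.active z x) μ z y) (P.dxL z x μ) x := by
  refine HasFDerivAt.const_add _ (HasFDerivAt.fun_sum fun j _ => HasFDerivAt.const_mul
    (HasFDerivAt.sub ?_ (differentiable_btilde hb j x).hasFDerivAt) _)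
  convert (ContinuousLinearMap.hasFDerivAt _).comp x (differentiable_Atilde ha ha_ne j x).hasFDerivAt
    using 1
  ext y
  simp [dotProduct, mul_comm]

theorem multipliers_eq_setOf_hasFDerivAt (z : Fin (l + 1) → ℝ) (x : EuclideanSpace ℝ (Fin n)) :
    P.multipliers z x = {μ | HasFDerivAt (fun w => P.lagrangian (P.active z x) μ w x)
      (0 : (Fin (l + 1) → ℝ) →L[ℝ] ℝ) z ∧ 0 ≤ μ} := by
  rw [multipliers_eq]
  ext μ
  refine and_congr_left fun _ => ?_
  set v := q l + ∑ j : P.active z x, μ j • P.Atilde x (j : Fin (N + 1)) with hv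
  set f : (Fin (l + 1) → ℝ) →L[ℝ] ℝ :=
    ∑ i : Fin (l + 1), v i • ContinuousLinearMap.proj (R := ℝ) (φ := fun _ => ℝ) i
  have hf : ∀ w, f w = v ⬝ᵥ w := fun w => by simp [f, dotProduct]
  have hder : HasFDerivAt (fun w => P.lagrangian (P.active z x) μ w x) f z := by
    have : (fun w => P.lagrangian (P.active z x) μ w x) =
        fun w => f w - ∑ j : P.active z x, μ j * P.btilde x (j : Fin (N + 1)) := by
      ext w
      rw [hf, hv, add_dotProduct, sum_dotProduct]
      simp only [lagrangian, mul_sub, Finset.sum_sub_distrib, smul_dotProduct, smul_eq_mul]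
      ring
    rw [this]
    exact f.hasFDerivAt.sub_const _
  have hv0 : ∑ j : P.active z x, μ j • P.Atilde x (j : Fin (N + 1)) = -q l ↔ v = 0 := by
    rw [eq_neg_iff_add_eq_zero (b := q l), hv, add_comm (q l)]
  refine hv0.trans ?_
  constructor
  · intro h
    convert hder
    ext w
    simp [hf, h]
  · intro h
    have h0 := hder.unique h
    rw [← dotProduct_self_eq_zero, ← hf, h0]
    rfl

/-! ### The directional derivative -/

theorem hasDerivAt_ray {E : Type*} [NormedAddCommGroup E] [NormedSpace ℝ E]
    {f : EuclideanSpace ℝ (Fin n) → E} (hf : Differentiable ℝ f)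
    (x d : EuclideanSpace ℝ (Fin n)) :
    HasDerivAt (fun t : ℝ => f (x + t • d)) (fderiv ℝ f x d) 0 := by
  have h : HasDerivAt (fun t : ℝ => x + t • d) d 0 := by
    simpa using ((hasDerivAt_id (0 : ℝ)).smul_const d).const_add x
  have h' : HasFDerivAt f (fderiv ℝ f x) (x + (0 : ℝ) • d) := by
    simpa using (hf x).hasFDerivAt
  exact h'.comp_hasDerivAt 0 h

theorem eventually_ray_mem_domainA (ha : ∀ j, ContDiff ℝ 1 (P.a j))
    (hb : ∀ j, ContDiff ℝ 1 (P.b j)) (ha_ne : ∀ j x, P.a j x ≠ 0)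
    {x : EuclideanSpace ℝ (Fin n)} (hx : x ∈ P.domainA) (d : EuclideanSpace ℝ (Fin n)) :
    ∀ᶠ t in 𝓝[>] (0 : ℝ), x + t • d ∈ P.domainA := by
  have hc : ContinuousAt (fun t : ℝ => x + t • d) 0 := by fun_prop
  refine (hc.eventually_mem ?_).filter_mono nhdsWithin_le_nhds
  simpa using (isOpen_domainA ha hb ha_ne).mem_nhds hx

/-- Primal half of the directional derivative: at a feasible point `z`, a level `γ` of the cost
derivative is reached by a feasible ray `z + t w`, unless a multiplier certifies the contrary. -/
theorem exists_feasible_ray_or_exists_multiplier (ha : ∀ j, ContDiff ℝ 1 (P.a j))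
    (hb : ∀ j, ContDiff ℝ 1 (P.b j)) (ha_ne : ∀ j x, P.a j x ≠ 0)
    {x : EuclideanSpace ℝ (Fin n)} (hx : x ∈ P.domainA) (d : EuclideanSpace ℝ (Fin n))
    {z : Fin (l + 1) → ℝ} (hz : z ∈ P.feasible x) (γ : ℝ) :
    (∃ w, q l ⬝ᵥ w < γ ∧ ∀ᶠ t in 𝓝[>] (0 : ℝ), z + t • w ∈ P.feasible (x + t • d)) ∨
      ∃ μ ∈ P.multipliers z x, γ ≤ P.dxL z x μ d := by
  obtain ⟨u, hu⟩ := exists_active_descent (fun j => ha_ne j x) hx z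
  rcases exists_descent_or_exists_multiplier
      (fun j : P.active z x => P.Atilde x (j : Fin (N + 1)))
      (fun j => fderiv ℝ (fun y => P.Atilde y (j : Fin (N + 1))) x d ⬝ᵥ z -
        fderiv ℝ (fun y => P.btilde y (j : Fin (N + 1))) x d) (q l) γ hu with
    ⟨w, hw, hqw⟩ | ⟨μ, hμ0, hμ, hγ⟩
  · refine Or.inl ⟨w, hqw, ?_⟩
    refine eventually_feasible_of_strict
      (A := fun t j => P.Atilde (x + t • d) j) (b := fun t j => P.btilde (x + t • d) j)
      (fun j => hasDerivAt_ray (differentiable_Atilde ha ha_ne j) x d)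
      (fun j => hasDerivAt_ray (differentiable_btilde hb j) x d) ?_ ?_
    · simpa using mem_feasible_iff.1 hz
    · simp only [zero_smul, add_zero]
      exact fun j hj => hw ⟨j, mem_active.2 hj⟩
  · refine Or.inr ⟨μ, ?_, ?_⟩
    · rw [multipliers_eq]
      exact ⟨hμ, hμ0⟩
    · rwa [dxL_apply]

theorem multipliers_nonempty (ha : ∀ j, ContDiff ℝ 1 (P.a j))
    (hb : ∀ j, ContDiff ℝ 1 (P.b j)) (ha_ne : ∀ j x, P.a j x ≠ 0)
    {x : EuclideanSpace ℝ (Fin n)} (hx : x ∈ P.domainA) {z : Fin (l + 1) → ℝ}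
    (hz : z ∈ P.solutions x) : (P.multipliers z x).Nonempty := by
  -- along the constant ray `d = 0` an optimal point admits no feasible direction of descent
  rcases exists_feasible_ray_or_exists_multiplier ha hb ha_ne hx 0 hz.1 0 with
    ⟨w, hw, hev⟩ | ⟨μ, hμ, -⟩
  · obtain ⟨t, ht, ht0⟩ := (hev.and self_mem_nhdsWithin).exists
    have ht0' : (0 : ℝ) < t := ht0
    rw [smul_zero, add_zero] at ht
    have := hz.2 _ ht
    rw [dotProduct_add, dotProduct_smul, smul_eq_mul] at this
    nlinarith
  · exact ⟨μ, hμ⟩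

theorem exists_isLeast_multipliers (ha : ∀ j, ContDiff ℝ 1 (P.a j))
    (hb : ∀ j, ContDiff ℝ 1 (P.b j)) (ha_ne : ∀ j x, P.a j x ≠ 0)
    {x : EuclideanSpace ℝ (Fin n)} (hx : x ∈ P.domainA) (d : EuclideanSpace ℝ (Fin n))
    {z : Fin (l + 1) → ℝ} (hz : z ∈ P.solutions x) :
    ∃ m, IsLeast ((fun μ => -(P.dxL z x μ d)) '' P.multipliers z x) m :=
  ((isCompact_multipliers (fun j => ha_ne j x) hx z).image
    (by simp only [dxL_apply]; fun_prop)).exists_isLeast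
      ((multipliers_nonempty ha hb ha_ne hx hz).image _)

/-- Limits of solutions of the perturbed programs are solutions: they are feasible because the data
are continuous, and optimal because every solution `y` is the start of a feasible ray. -/
theorem mem_solutions_of_tendsto (ha : ∀ j, ContDiff ℝ 1 (P.a j))
    (hb : ∀ j, ContDiff ℝ 1 (P.b j)) (ha_ne : ∀ j x, P.a j x ≠ 0)
    {x : EuclideanSpace ℝ (Fin n)} (hx : x ∈ P.domainA) (d : EuclideanSpace ℝ (Fin n))
    {y : Fin (l + 1) → ℝ} (hy : y ∈ P.solutions x) {U : Filter ℝ} [U.NeBot]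
    (hU : U ≤ 𝓝[>] 0) {zt : ℝ → Fin (l + 1) → ℝ} {z : Fin (l + 1) → ℝ}
    (hzt : Tendsto zt U (𝓝 z)) (hsol : ∀ᶠ t in U, zt t ∈ P.solutions (x + t • d)) :
    z ∈ P.solutions x := by
  have hU0 : Tendsto (fun t : ℝ => t) U (𝓝 0) := hU.trans nhdsWithin_le_nhds
  have hq : Tendsto (fun t => q l ⬝ᵥ zt t) U (𝓝 (q l ⬝ᵥ z)) := by
    simp only [q_dotProduct]
    exact (tendsto_pi_nhds.1 hzt _).neg
  have hfeas : z ∈ P.feasible x := by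
    rw [mem_feasible_iff]
    intro j
    have hA := (hasDerivAt_ray (differentiable_Atilde ha ha_ne j) x d).continuousAt.tendsto.comp hU0
    have hB := (hasDerivAt_ray (differentiable_btilde hb j) x d).continuousAt.tendsto.comp hU0
    simp only [zero_smul, add_zero] at hA hB
    refine le_of_tendsto_of_tendsto (tendsto_finsetSum _ fun i _ =>
      (tendsto_pi_nhds.1 hA i).mul (tendsto_pi_nhds.1 hzt i)) hB ?_
    exact hsol.mono fun t ht => mem_feasible_iff.1 ht.1 j
  refine ⟨hfeas, fun w hw => le_trans ?_ (hy.2 w hw)⟩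
  obtain ⟨m, hm⟩ := exists_isLeast_multipliers ha hb ha_ne hx d hy
  -- no multiplier reaches the level `1 - m`
  rcases exists_feasible_ray_or_exists_multiplier ha hb ha_ne hx d hy.1 (1 - m) with
    ⟨w, -, hev⟩ | ⟨μ, hμ, hle⟩
  · have hlim : Tendsto (fun t => q l ⬝ᵥ (y + t • w)) U (𝓝 (q l ⬝ᵥ y)) := by
      have : Tendsto (fun t : ℝ => q l ⬝ᵥ y + t * q l ⬝ᵥ w) U
          (𝓝 (q l ⬝ᵥ y + 0 * q l ⬝ᵥ w)) := (hU0.mul_const _).const_add _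
      simpa [dotProduct_add, dotProduct_smul] using this
    refine le_of_tendsto_of_tendsto hq hlim ?_
    filter_upwards [hsol, hev.filter_mono hU] with t ht hf
    exact ht.2 _ hf
  · have := hm.2 ⟨μ, hμ, rfl⟩
    simp only at this
    linarith

/-- The max-min formula, with the inner minimum written as a function `m` on the solution set.
Feasible rays bound the difference quotient below by every `m z`; a limit `z` of perturbed solutions
along an ultrafilter, paired with a multiplier that attains `m z`, bounds it above by `m z`. -/
theorem exists_isGreatest_and_tendsto_hr (hN : 1 ≤ N) (ha : ∀ j, ContDiff ℝ 1 (P.a j))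
    (hb : ∀ j, ContDiff ℝ 1 (P.b j)) (ha_ne : ∀ j x, P.a j x ≠ 0)
    (hbdd : ∃ D : Set (EuclideanSpace ℝ (Fin l)), IsCompact D ∧ ∀ x, P.Phi x ⊆ D) (ε₀ : ℝ)
    {x : EuclideanSpace ℝ (Fin n)} (hx : x ∈ P.domainA) (d : EuclideanSpace ℝ (Fin n))
    {m : (Fin (l + 1) → ℝ) → ℝ} (hm : ∀ z ∈ P.solutions x,
      IsLeast ((fun μ => -(P.dxL z x μ d)) '' P.multipliers z x) (m z)) :
    ∃ v, IsGreatest (m '' P.solutions x) v ∧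
      Tendsto (fun t : ℝ => (P.hr ε₀ (x + t • d) - P.hr ε₀ x) / t) (𝓝[>] (0 : ℝ)) (𝓝 v) := by
  obtain ⟨R, hR⟩ := exists_feasible_subset_closedBall hN ha_ne hbdd
  obtain ⟨y, hy⟩ := solutions_nonempty (fun j => ha_ne j x) (hR x) hx
  have hex : ∀ t : ℝ, ∃ z, x + t • d ∈ P.domainA → z ∈ P.solutions (x + t • d) := fun t => by
    by_cases ht : x + t • d ∈ P.domainA
    · obtain ⟨z, hz⟩ := solutions_nonempty (fun j => ha_ne j _) (hR _) ht
      exact ⟨z, fun _ => hz⟩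
    · exact ⟨0, fun h => absurd h ht⟩
  choose zt hzt using hex
  have hsol : ∀ᶠ t in 𝓝[>] (0 : ℝ), zt t ∈ P.solutions (x + t • d) :=
    (eventually_ray_mem_domainA ha hb ha_ne hx d).mono hzt
  refine exists_isGreatest_and_tendsto (fun z hz r hr => ?_) fun U hU => ?_
  · rcases exists_feasible_ray_or_exists_multiplier ha hb ha_ne hx d hz.1 (-r) with
      ⟨w, hw, hev⟩ | ⟨μ, hμ, hle⟩
    · filter_upwards [hev, hsol, self_mem_nhdsWithin] with t ht hs ht0
      have ht0' : (0 : ℝ) < t := ht0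
      have h := hs.2 _ ht
      rw [dotProduct_add, dotProduct_smul, smul_eq_mul] at h
      rw [le_div_iff₀ ht0', hr_eq hs, hr_eq hz]
      nlinarith
    · have := (hm z hz).2 ⟨μ, hμ, rfl⟩
      simp only at this
      linarith
  · have hbd : ∀ᶠ t in (U : Filter ℝ), zt t ∈ Metric.closedBall (0 : Fin (l + 1) → ℝ) R :=
      (hsol.filter_mono hU).mono fun t ht => hR _ ht.1
    obtain ⟨z, -, hz⟩ := (isCompact_closedBall (0 : Fin (l + 1) → ℝ) R).ultrafilter_le_nhds
      (U.map zt) (le_principal_iff.2 hbd)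
    have hz' : Tendsto zt U (𝓝 z) := hz
    have hzS := mem_solutions_of_tendsto ha hb ha_ne hx d hy hU hz' (hsol.filter_mono hU)
    refine ⟨z, hzS, fun r hr => ?_⟩
    obtain ⟨μ, hμ, hμm⟩ := (hm z hzS).1
    rw [multipliers_eq] at hμ
    obtain ⟨ψ, hψ, hle⟩ := exists_tendsto_le_of_multiplier
      (A := fun t (j : P.active z x) => P.Atilde (x + t • d) j)
      (b := fun t (j : P.active z x) => P.btilde (x + t • d) j) (q := q l) (μ := μ)
      (fun j => hasDerivAt_ray (differentiable_Atilde ha ha_ne j) x d)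
      (fun j => hasDerivAt_ray (differentiable_btilde hb j) x d)
      (z := z) (by simpa using fun j hj => mem_active.1 hj) hμ.2 (by simpa using hμ.1) hU hz'
      ((hsol.filter_mono hU).mono fun t ht j => mem_feasible_iff.1 ht.1 j)
    rw [← dxL_apply] at hψ
    simp only at hμm
    filter_upwards [hle, hψ.eventually_const_lt (show -r < P.dxL z x μ d by linarith),
      hsol.filter_mono hU] with t h1 h2 hs
    rw [hr_eq hs, hr_eq hzS]
    have : (-ε₀ - q l ⬝ᵥ zt t - (-ε₀ - q l ⬝ᵥ z)) / t = -((q l ⬝ᵥ zt t - q l ⬝ᵥ z) / t) := by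
      ring
    linarith

end ParamPolytope

theorem proposition2 {n l N : ℕ} (hN : 1 ≤ N) (P : ParamPolytope n l N)
    (ha : ∀ j, ContDiff ℝ 1 (P.a j)) (hb : ∀ j, ContDiff ℝ 1 (P.b j))
    (ha_ne : ∀ j x, P.a j x ≠ 0)
    (hbdd : ∃ D : Set (EuclideanSpace ℝ (Fin l)), IsCompact D ∧ ∀ x, P.Phi x ⊆ D)
    (ε₀ : ℝ) (hε₀ : 0 < ε₀) :
    -- the linear program that defines `h_r` has a minimizer at every point of the domain
    (∀ x ∈ P.domainA, (P.solutions x).Nonempty) ∧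
    -- the multiplier set is compact, and it and `∂ₓL` come from the local Lagrangian
    (∀ x ∈ P.domainA, ∀ z ∈ P.feasible x,
      IsCompact (P.multipliers z x) ∧
      (∀ μ : P.active z x → ℝ,
        HasFDerivAt (fun y => P.lagrangian (P.active z x) μ z y) (P.dxL z x μ) x) ∧
      P.multipliers z x =
        {μ | HasFDerivAt (fun w => P.lagrangian (P.active z x) μ w x)
              (0 : (Fin (l + 1) → ℝ) →L[ℝ] ℝ) z ∧ 0 ≤ μ}) ∧
    -- the directional derivative is `max_{z ∈ S(x)} min_{μ ∈ M(z,x)} -∂ₓL(μ,z,x) d`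
    (∀ x ∈ P.domainA, ∀ d : EuclideanSpace ℝ (Fin n),
      ∃ (m : (Fin (l + 1) → ℝ) → ℝ) (v : ℝ),
        (∀ z ∈ P.solutions x,
          IsLeast ((fun μ => -(P.dxL z x μ d)) '' P.multipliers z x) (m z)) ∧
        IsGreatest (m '' P.solutions x) v ∧
        HasDirDerivOn P.domainA (P.hr ε₀) x d v) := by
  obtain ⟨R, hR⟩ := ParamPolytope.exists_feasible_subset_closedBall hN ha_ne hbdd
  refine ⟨fun x hx => ParamPolytope.solutions_nonempty (fun j => ha_ne j x) (hR x) hx,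
    fun x hx z _ => ⟨ParamPolytope.isCompact_multipliers (fun j => ha_ne j x) hx z,
      ParamPolytope.hasFDerivAt_lagrangian_state ha hb ha_ne z x,
      ParamPolytope.multipliers_eq_setOf_hasFDerivAt z x⟩, fun x hx d => ?_⟩
  have hex : ∀ z ∈ P.solutions x, ∃ m,
      IsLeast ((fun μ => -(P.dxL z x μ d)) '' P.multipliers z x) m :=
    fun z hz => ParamPolytope.exists_isLeast_multipliers ha hb ha_ne hx d hz
  choose! m hm using hex
  obtain ⟨v, hv, hlim⟩ :=
    ParamPolytope.exists_isGreatest_and_tendsto_hr hN ha hb ha_ne hbdd ε₀ hx d hm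
  exact ⟨m, v, hm, hv, ParamPolytope.eventually_ray_mem_domainA ha hb ha_ne hx d, hlim⟩
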